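/- All Banach spaces are real. For a Banach space $X$ and a set $B\subset X^*$, the (I)-envelope of $B$ is $$\operatorname{(I)-env}(B)=\bigcap\left\{\overline{\operatorname{co}\bigcup_{n=1}^\infty \overline{\operatorname{co} C_n}^{\,w^*}}^{\,\|\cdot\|}:\ B=\bigcup_{n=1}^\infty C_n \right\},$$ where the intersection runs over all sequences $(C_n)$ of sets with union $B$, $\operatorname{co}$ denotes the convex hull, $\overline{\,\cdot\,}^{\,w^*}$ the weak$^*$ closure in $X^*$ and $\overline{\,\cdot\,}^{\,\|\cdot\|}$ the norm closure in $X^*$. A subset of a Banach space $E$ is regarded, through the canonical embedding $E\subset E^{**}$, as a subset of $E^{**}=(E^*)^*$, and its (I)-envelope is formed in $E^{**}$. For a Banach space $Y$ write $B_Y$ for its closed unit ball. **Theorem.** Let $\Gamma$ be an arbitrary set and let $E=\ell_\infty(\Gamma)$ be the Banach space of all bounded functions $\Gamma\to\mathbb R$ with the supremum norm. Then $$\operatorname{(I)-env}(B_E)=B_{E^{**}}.$$ -/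

import Mathlib

open scoped ENNReal

/-- The weak-star closure, in the dual of a real normed space `X`, of a set of functionals. -/
def weakStarClosure {X : Type*} [NormedAddCommGroup X] [NormedSpace ℝ X]
    (A : Set (StrongDual ℝ X)) : Set (StrongDual ℝ X) :=
  StrongDual.toWeakDual ⁻¹' closure ((StrongDual.toWeakDual : StrongDual ℝ X → WeakDual ℝ X) '' A)

/-- The (I)-envelope of a set `B` in the dual of a real normed space `X`: the intersection, over
all countable covers `B = ⋃ n, C n`, of the norm closures of the convex hulls of the unions of the
weak-star closed convex hulls of the `C n`. -/
def iEnvelope {X : Type*} [NormedAddCommGroup X] [NormedSpace ℝ X]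
    (B : Set (StrongDual ℝ X)) : Set (StrongDual ℝ X) :=
  ⋂ (C : ℕ → Set (StrongDual ℝ X)) (_ : B = ⋃ n, C n),
    closure (convexHull ℝ (⋃ n, weakStarClosure (convexHull ℝ (C n))))

/-- The (I)-envelope of a set `B` in a real normed space `E`: the (I)-envelope, formed in the
bidual (the dual of `StrongDual ℝ E`), of the canonical image of `B`. -/
def iEnvelopeInBidual {E : Type*} [NormedAddCommGroup E] [NormedSpace ℝ E]
    (B : Set E) : Set (StrongDual ℝ (StrongDual ℝ E)) :=
  iEnvelope (NormedSpace.inclusionInDoubleDual ℝ E '' B)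

/-! The constant cover bounds the envelope by the ball. Conversely, let `F` in the bidual ball lie
outside the envelope. A bad cover `C` stays at distance more than some `ε` from `F`. The first `n`
weak-star closed convex hulls lie in a compact convex set, so Hahn-Banach gives `ξ n` in the unit
ball of the dual with `G (ξ n) + ε ≤ F (ξ n)` on `C i`, `i < n`. Each point of the unit ball is
eventually separated from `F` in this way, so it suffices to find one `b` in that ball with `ξ n b ≥
F (ξ n) - ε / 2` for infinitely many `n` (`iEnvelopeInBidual_closedBall_eq`).

Functionals on `ℓ∞(Γ)` are finitely additive signed measures. Let `ν` be a weighted sum of their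
variations. Along a subsequence there are disjoint sets `O k` such that the functionals are nearly
uniformly `ν`-continuous off `O k` and put little mass on the other `O j`
(`exists_subsequence_splitting`, by way of Rosenthal's lemma). Off `O k`, the Hilbertian seminorm of
`L²(ν)` yields one `b` approximating `F` on all the restrictions (`exists_uniform_approx`). On `O
k`, a function nearly attaining the variation does at least almost as well as `F`. Gluing these
functions works since the `O k` are disjoint (`exists_infinite_almost_le`). -/

open Filter Topology

/-! ### Finitely additive contents -/

/-- A nonnegative finitely additive set function defined on all subsets of `α`. -/
structure IsContent {α : Type*} (m : Set α → ℝ) : Prop where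
  nonneg : ∀ A, 0 ≤ m A
  union : ∀ A B, Disjoint A B → m (A ∪ B) = m A + m B

namespace IsContent

variable {α : Type*} {m : Set α → ℝ}

lemma empty (h : IsContent m) : m ∅ = 0 := by
  have := h.union ∅ ∅ (Set.disjoint_empty _)
  simp at this
  exact this

lemma diff_add (h : IsContent m) {A B : Set α} (hAB : A ⊆ B) : m (B \ A) + m A = m B := by
  rw [← h.union _ _ Set.disjoint_sdiff_left, Set.sdiff_union_of_subset hAB]

lemma mono (h : IsContent m) {A B : Set α} (hAB : A ⊆ B) : m A ≤ m B := by
  have := h.diff_add hAB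
  have := h.nonneg (B \ A)
  linarith

lemma union_le (h : IsContent m) (A B : Set α) : m (A ∪ B) ≤ m A + m B := by
  rw [← Set.sdiff_union_self, h.union _ _ Set.disjoint_sdiff_left]
  have := h.mono (Set.sdiff_subset : A \ B ⊆ A)
  linarith

lemma le_diff_add (h : IsContent m) (A B : Set α) : m A ≤ m (A \ B) + m B :=
  (h.mono (by intro x hx; by_cases hB : x ∈ B <;> simp [hx, hB])).trans (h.union_le _ _)

lemma biUnion_le (h : IsContent m) {ι : Type*} (s : Finset ι) (A : ι → Set α) :
    m (⋃ i ∈ s, A i) ≤ ∑ i ∈ s, m (A i) := by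
  classical
  induction s using Finset.induction_on with
  | empty => simp [h.empty]
  | insert i s hi ih =>
    rw [Finset.set_biUnion_insert, Finset.sum_insert hi]
    exact (h.union_le _ _).trans (by linarith)

lemma sum_le (h : IsContent m) {ι : Type*} (s : Finset ι) (A : ι → Set α)
    (hA : (s : Set ι).PairwiseDisjoint A) {B : Set α} (hB : ∀ i ∈ s, A i ⊆ B) :
    ∑ i ∈ s, m (A i) ≤ m B := by
  classical
  suffices ∑ i ∈ s, m (A i) = m (⋃ i ∈ s, A i) by
    rw [this]
    exact h.mono (Set.iUnion₂_subset hB)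
  clear hB
  induction s using Finset.induction_on with
  | empty => simp [h.empty]
  | insert i s hi ih =>
    rw [Finset.set_biUnion_insert, Finset.sum_insert hi, h.union,
      ih (hA.subset (by simp))]
    refine Set.disjoint_iUnion₂_right.2 fun j hj => hA (by simp) (by simp [hj]) ?_
    rintro rfl
    exact hi hj

end IsContent

/-! ### Disjointification, Rosenthal's lemma and subsequence splitting -/

section Content

variable {α : Type*}

lemma sum_half_pow_le {c : ℝ} (hc : 0 ≤ c) (s : Finset ℕ) : ∑ j ∈ s, c * (1 / 2) ^ j ≤ 2 * c := by
  rw [← Finset.mul_sum]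
  have : ∑ j ∈ s, (1 / 2 : ℝ) ^ j ≤ 2 := by
    refine (summable_geometric_two.sum_le_tsum s fun _ _ => by positivity).trans_eq ?_
    exact tsum_geometric_two
  nlinarith

/-- An ultrafilter limit of uniformly bounded contents. -/
lemma exists_ultrafilter_limit (U : Ultrafilter ℕ) {μ : ℕ → Set α → ℝ}
    (hμ : ∀ n, IsContent (μ n)) (h1 : ∀ n, μ n Set.univ ≤ 1) :
    ∃ v : Set α → ℝ, IsContent v ∧ v Set.univ ≤ 1 ∧ ∀ A, Tendsto (fun n => μ n A) U (𝓝 (v A)) := by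
  have key : ∀ A, ∃ a, Tendsto (fun n => μ n A) U (𝓝 a) := fun A => by
    obtain ⟨a, -, ha⟩ := (isCompact_Icc (a := (0 : ℝ)) (b := 1)).ultrafilter_le_nhds
      (U.map fun n => μ n A) (by
        simp only [le_principal_iff]
        exact Ultrafilter.mem_map.2 (Filter.univ_mem' fun n =>
          ⟨(hμ n).nonneg A, ((hμ n).mono (Set.subset_univ A)).trans (h1 n)⟩))
    exact ⟨a, ha⟩
  choose v hv using key
  refine ⟨v, ⟨fun A => ?_, fun A B hAB => ?_⟩, ?_, hv⟩
  · exact ge_of_tendsto' (hv A) fun n => (hμ n).nonneg A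
  · refine tendsto_nhds_unique (hv _) (((hv A).add (hv B)).congr fun n => ?_)
    rw [(hμ n).union _ _ hAB]
  · exact le_of_tendsto' (hv _) h1

/-- Sets `A n` carrying a fixed amount of mass of `μ n`, and nearly null for all earlier contents,
can be shrunk, along a subsequence, to disjoint sets without losing much mass. -/
lemma exists_disjoint_subsets {μ : ℕ → Set α → ℝ} (hμ : ∀ n, IsContent (μ n))
    (h1 : ∀ n, μ n Set.univ ≤ 1) {A : ℕ → Set α} {a ε : ℝ} (hε : 0 < ε)
    (hA : ∀ n, a ≤ μ n (A n)) (hsmall : ∀ n j, n < j → μ n (A j) ≤ ε * (1 / 2) ^ j) :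
    ∃ (φ : ℕ → ℕ) (O : ℕ → Set α), φ.Injective ∧ Pairwise (Function.onFun Disjoint O) ∧
      (∀ k, O k ⊆ A (φ k)) ∧ ∀ k, a - 4 * ε ≤ μ (φ k) (O k) := by
  classical
  set U : Ultrafilter ℕ := hyperfilter ℕ
  obtain ⟨v, hv, hv1, hlim⟩ := exists_ultrafilter_limit U hμ h1
  -- For fixed `p` the sets `N n p`, `n < p`, are disjoint; deleting the later `A j` costs at most
  -- `2 * ε`.
  set N : ℕ → ℕ → Set α := fun n p => A n \ ⋃ j ∈ Finset.Ioo n p, A j with hN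
  have hmass : ∀ n p, a - 2 * ε ≤ μ n (N n p) := fun n p => by
    have e1 := (hμ n).le_diff_add (A n) (⋃ j ∈ Finset.Ioo n p, A j)
    have e2 := (hμ n).biUnion_le (Finset.Ioo n p) A
    have e3 : ∑ j ∈ Finset.Ioo n p, μ n (A j) ≤ ∑ j ∈ Finset.Ioo n p, ε * (1 / 2) ^ j :=
      Finset.sum_le_sum fun j hj => hsmall n j (Finset.mem_Ioo.1 hj).1
    have e4 := sum_half_pow_le hε.le (Finset.Ioo n p)
    have := hA n
    simp only [hN]
    linarith
  have hdisj : ∀ n n' p, n < n' → n' < p → Disjoint (N n p) (N n' p) := fun n n' p h h' => by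
    refine Set.disjoint_left.2 fun x hx hx' => hx.2 ?_
    exact Set.mem_biUnion (Finset.mem_coe.2 (Finset.mem_Ioo.2 ⟨h, h'⟩)) hx'.1
  -- Otherwise more than `1 / δ` disjoint sets would each have `v`-mass at least `δ`, against `v
  -- Set.univ ≤ 1`.
  have hclaim : ∀ T : Set ℕ, T.Infinite → ∀ δ > 0, ∃ n ∈ T, ∃ p, v (N n p) < δ := by
    intro T hT δ hδ
    by_contra! hcon
    obtain ⟨L, hL⟩ := exists_nat_gt (1 / δ)
    obtain ⟨s, hsT, hs⟩ := hT.exists_subset_card_eq L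
    obtain ⟨p, hp⟩ := s.bddAbove
    have e := hv.sum_le s (fun n => N n (p + 1)) (fun n hn n' hn' hne => by
      rcases lt_or_gt_of_ne hne with h | h
      · exact hdisj _ _ _ h (Nat.lt_succ_of_le (hp hn'))
      · exact (hdisj _ _ _ h (Nat.lt_succ_of_le (hp hn))).symm) (fun i _ => Set.subset_univ _)
    have e2 : ∑ n ∈ s, δ ≤ ∑ n ∈ s, v (N n (p + 1)) :=
      Finset.sum_le_sum fun n hn => hcon n (hsT hn) _
    rw [Finset.sum_const, hs, nsmul_eq_mul] at e2
    rw [div_lt_iff₀ hδ] at hL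
    linarith
  -- A triple is (stage counter, `n`, `p`). Small `v`-mass of the chosen `N n p` makes its `μ
  -- m`-mass small for `U`-many `m`, so the next index can be taken there. Deleting all earlier
  -- chosen sets then costs at most another `2 * ε`.
  obtain ⟨f, hf, hr⟩ := exists_seq_of_forall_finset_exists
    (fun t : ℕ × ℕ × ℕ => v (N t.2.1 t.2.2) < ε * (1 / 2) ^ t.1)
    (fun t t' => t.1 < t'.1 ∧ t.2.1 < t'.2.1 ∧ μ t'.2.1 (N t.2.1 t.2.2) < ε * (1 / 2) ^ t.1) (by
      intro s hs
      obtain ⟨k, hk⟩ := (s.image Prod.fst).bddAbove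
      have hT : {m | ∀ t ∈ s, t.2.1 < m ∧ μ m (N t.2.1 t.2.2) < ε * (1 / 2) ^ t.1} ∈ U := by
        have : ∀ᶠ m in (U : Filter ℕ), ∀ t ∈ s,
            t.2.1 < m ∧ μ m (N t.2.1 t.2.2) < ε * (1 / 2) ^ t.1 := by
          rw [Filter.eventually_all_finset]
          intro t ht
          refine Filter.Eventually.and ?_ ((hlim _).eventually_lt_const (hs t ht))
          exact Nat.hyperfilter_le_atTop (eventually_gt_atTop _)
        exact this
      have hinf : {m | ∀ t ∈ s, t.2.1 < m ∧ μ m (N t.2.1 t.2.2) < ε * (1 / 2) ^ t.1}.Infinite :=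
        fun hfin => notMem_hyperfilter_of_finite hfin hT
      obtain ⟨n, hn, p, hp⟩ := hclaim _ hinf (ε * (1 / 2) ^ (k + 1)) (by positivity)
      refine ⟨(k + 1, n, p), hp, fun t ht => ⟨?_, hn t ht⟩⟩
      exact Nat.lt_succ_of_le (hk (Finset.mem_coe.2 (Finset.mem_image_of_mem _ ht))))
  have hmono : StrictMono fun k => (f k).1 := fun i j hij => (hr i j hij).1
  have hmono' : StrictMono fun k => (f k).2.1 := fun i j hij => (hr i j hij).2.1
  refine ⟨fun k => (f k).2.1, fun k => N (f k).2.1 (f k).2.2 \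
    ⋃ j ∈ Finset.range k, N (f j).2.1 (f j).2.2, hmono'.injective, ?_, ?_, ?_⟩
  · have : ∀ i j, i < j → Disjoint
        (N (f i).2.1 (f i).2.2 \ ⋃ l ∈ Finset.range i, N (f l).2.1 (f l).2.2)
        (N (f j).2.1 (f j).2.2 \ ⋃ l ∈ Finset.range j, N (f l).2.1 (f l).2.2) := by
      refine fun i j hij => Set.disjoint_left.2 fun x hx hx' => hx'.2 ?_
      exact Set.mem_biUnion (Finset.mem_coe.2 (Finset.mem_range.2 hij)) hx.1
    intro i j hij
    rcases lt_or_gt_of_ne hij with h | h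
    · exact this _ _ h
    · exact (this _ _ h).symm
  · exact fun k => Set.sdiff_subset.trans Set.sdiff_subset
  · intro k
    have e1 := (hμ (f k).2.1).le_diff_add (N (f k).2.1 (f k).2.2)
      (⋃ j ∈ Finset.range k, N (f j).2.1 (f j).2.2)
    have e2 := (hμ (f k).2.1).biUnion_le (Finset.range k) fun j => N (f j).2.1 (f j).2.2
    have e3 : ∑ j ∈ Finset.range k, μ (f k).2.1 (N (f j).2.1 (f j).2.2) ≤
        ∑ j ∈ Finset.range k, ε * (1 / 2) ^ j :=
      Finset.sum_le_sum fun j hj => by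
        refine ((hr j k (Finset.mem_range.1 hj)).2.2.le).trans ?_
        refine mul_le_mul_of_nonneg_left ?_ hε.le
        exact pow_le_pow_of_le_one (by norm_num) (by norm_num) (hmono.le_apply)
    have e4 := sum_half_pow_le hε.le (Finset.range k)
    have e5 := hmass (f k).2.1 (f k).2.2
    linarith

/-- **Rosenthal's lemma** for contents on a power set. -/
lemma exists_rosenthal_subsequence {ε : ℝ} (hε : 0 < ε) (M : ℕ) :
    ∀ {μ : ℕ → Set α → ℝ}, (∀ n, IsContent (μ n)) → ∀ {O : ℕ → Set α},
      Pairwise (Function.onFun Disjoint O) → (∀ n, μ n (⋃ j, O j) ≤ M * ε) →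
      ∃ φ : ℕ → ℕ, φ.Injective ∧ ∀ k, μ (φ k) (⋃ j ≠ k, O (φ j)) ≤ ε := by
  induction M with
  | zero =>
    intro μ hμ O hO hM
    refine ⟨id, Function.injective_id, fun k => ?_⟩
    have := (hμ k).mono (Set.iUnion₂_subset fun j _ => Set.subset_iUnion O j :
      (⋃ j ≠ k, O j) ⊆ ⋃ j, O j)
    have := hM k
    simp only [id]
    push_cast at this
    linarith
  | succ M ih =>
    intro μ hμ O hO hM
    by_contra hcon
    -- Split the indices into infinitely many rows `Nat.pair p ·`. If every row fails, one index per
    -- row carries mass above `ε` on the rest of its row. That mass misses the union over the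
    -- selected indices, so the bound there drops by `ε`.
    have hp : ∀ p, ∃ q, ε < μ (Nat.pair p q) (⋃ j ≠ q, O (Nat.pair p j)) := by
      intro p
      by_contra! h
      exact hcon ⟨fun q => Nat.pair p q, fun q q' h => (Nat.pair_eq_pair.1 h).2, h⟩
    choose q hq using hp
    have hinj : Function.Injective fun p => Nat.pair p (q p) :=
      fun p p' h => (Nat.pair_eq_pair.1 h).1
    obtain ⟨φ, hφ, hφ'⟩ := ih (μ := fun p => μ (Nat.pair p (q p)))
      (fun p => hμ _) (O := fun p => O (Nat.pair p (q p)))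
      (fun i j hij => hO fun h => hij (hinj h)) (fun p => by
        have hd : Disjoint (⋃ i, O (Nat.pair i (q i))) (⋃ j ≠ q p, O (Nat.pair p j)) := by
          refine Set.disjoint_iUnion_left.2 fun i => Set.disjoint_iUnion₂_right.2 fun j hj => hO ?_
          intro h
          obtain ⟨rfl, rfl⟩ := Nat.pair_eq_pair.1 h
          exact hj rfl
        have e1 := (hμ (Nat.pair p (q p))).union _ _ hd
        have e2 := (hμ (Nat.pair p (q p))).mono
          (Set.union_subset (Set.iUnion_subset fun i => Set.subset_iUnion O (Nat.pair i (q i)))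
            (Set.iUnion₂_subset fun j _ => Set.subset_iUnion O (Nat.pair p j)) :
            (⋃ i, O (Nat.pair i (q i))) ∪ (⋃ j ≠ q p, O (Nat.pair p j)) ⊆ ⋃ j, O j)
        have e3 := hM (Nat.pair p (q p))
        have e4 := hq p
        push_cast at e3
        linarith)
    exact hcon ⟨_, hinj.comp hφ, hφ'⟩

/-- A quantitative **subsequence splitting lemma**: along a subsequence, bounded contents dominated
by multiples of `ν` are, off disjoint sets `O k`, uniformly `ε`-absolutely continuous with
respect to `ν`. -/
lemma exists_subsequence_splitting {μ : ℕ → Set α → ℝ} (hμ : ∀ n, IsContent (μ n))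
    (h1 : ∀ n, μ n Set.univ ≤ 1) {ν : Set α → ℝ} (hν : IsContent ν) {c : ℕ → ℝ}
    (hc : ∀ n, 0 < c n) (hdom : ∀ n A, μ n A ≤ c n * ν A) {ε : ℝ} (hε : 0 < ε) :
    ∃ (φ : ℕ → ℕ) (O : ℕ → Set α) (η : ℝ), φ.Injective ∧ Pairwise (Function.onFun Disjoint O) ∧
      0 < η ∧ (∀ k, μ (φ k) (⋃ j ≠ k, O j) ≤ ε) ∧
      ∀ k B, ν B ≤ η → μ (φ k) (B \ O k) ≤ ε := by
  -- The infimum `d` of `S` is the least asymptotic failure of uniform `ν`-continuity over all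
  -- subsequences. A nearly optimal subsequence cannot be improved by passing to a tail, so
  -- `ν`-small sets of mass above `d - e` keep occurring.
  set S : Set ℝ := {a | ∃ φ : ℕ → ℕ, φ.Injective ∧ ∃ η > 0, ∀ k B, ν B ≤ η → μ (φ k) B ≤ a}
  have hSne : S.Nonempty := ⟨1, id, Function.injective_id, 1, one_pos,
    fun k B _ => ((hμ k).mono (Set.subset_univ B)).trans (h1 k)⟩
  have hSbdd : BddBelow S := by
    refine ⟨0, ?_⟩
    rintro a ⟨φ, -, η, hη, h⟩
    have := h 0 ∅ (by rw [hν.empty]; exact hη.le)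
    rwa [(hμ _).empty] at this
  set d := sInf S
  set e := ε / 10 with he
  have hepos : 0 < e := by positivity
  obtain ⟨a, ⟨φ, hφ, η, hη, hφη⟩, had⟩ := (Real.lt_sInf_add_pos hSne hepos)
  change a < d + e at had
  have hbig : ∀ δ > 0, ∀ N, ∃ n B, N < n ∧ ν B ≤ δ ∧ d - e < μ (φ n) B := by
    intro δ hδ N
    by_contra! h
    have : d - e ∈ S := ⟨fun k => φ (k + (N + 1)), hφ.comp (add_left_injective _), δ, hδ,
      fun k B hB => h _ B (by omega) hB⟩
    have := csInf_le hSbdd this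
    change d ≤ _ at this
    linarith
  obtain ⟨f, hf, hr⟩ := exists_seq_of_forall_finset_exists
    (fun t : ℕ × ℕ × Set α => ν t.2.2 ≤ η / 2 ∧ d - e < μ (φ t.2.1) t.2.2)
    (fun t t' => t.1 < t'.1 ∧ t.2.1 < t'.2.1 ∧ μ (φ t.2.1) t'.2.2 ≤ e * (1 / 2) ^ t'.1) (by
      intro s hs
      obtain ⟨k, hk⟩ := (s.image Prod.fst).bddAbove
      obtain ⟨N, hN⟩ := (s.image fun t => t.2.1).bddAbove
      -- Domination by `ν` makes every `ν`-small set negligible for the finitely many contents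
      -- already chosen.
      have hδ : ∃ δ > 0, ∀ t ∈ s, c (φ t.2.1) * δ ≤ e * (1 / 2) ^ (k + 1) := by
        clear hs hk hN
        induction s using Finset.cons_induction with
        | empty => exact ⟨1, one_pos, by simp⟩
        | cons t s _ ih =>
          obtain ⟨δ, hδ, h⟩ := ih
          have hct := hc (φ t.2.1)
          refine ⟨min δ (e * (1 / 2) ^ (k + 1) / c (φ t.2.1)), lt_min hδ (by positivity), ?_⟩
          intro t' ht'
          rcases Finset.mem_cons.1 ht' with rfl | ht'
          · calc _ ≤ c (φ t'.2.1) * (e * (1 / 2) ^ (k + 1) / c (φ t'.2.1)) := by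
                  gcongr; exact min_le_right _ _
              _ = _ := by field_simp
          · refine le_trans ?_ (h t' ht')
            have := (hc (φ t'.2.1)).le
            gcongr
            exact min_le_left _ _
      obtain ⟨δ, hδ, hδs⟩ := hδ
      obtain ⟨n, B, hn, hB, hBn⟩ := hbig (min δ (η / 2)) (lt_min hδ (by positivity)) N
      refine ⟨(k + 1, n, B), ⟨hB.trans (min_le_right _ _), hBn⟩, fun t ht => ⟨?_, ?_, ?_⟩⟩
      · exact Nat.lt_succ_of_le (hk (Finset.mem_coe.2 (Finset.mem_image_of_mem _ ht)))
      · exact lt_of_le_of_lt (hN (Finset.mem_coe.2 (Finset.mem_image_of_mem _ ht))) hn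
      · refine (hdom _ _).trans (le_trans ?_ (hδs t ht))
        have := (hc (φ t.2.1)).le
        gcongr
        exact hB.trans (min_le_left _ _))
  have hmono : StrictMono fun k => (f k).1 := fun i j hij => (hr i j hij).1
  have hmono' : StrictMono fun k => (f k).2.1 := fun i j hij => (hr i j hij).2.1
  obtain ⟨ψ, O, hψ, hO, hOA, hOm⟩ := exists_disjoint_subsets
    (μ := fun n => μ (φ (f n).2.1)) (fun n => hμ _) (fun n => h1 _)
    (A := fun n => (f n).2.2) (a := d - e) (ε := e) hepos (fun n => (hf n).2.le)
    (fun n j hnj => (hr n j hnj).2.2.trans (mul_le_mul_of_nonneg_left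
      (pow_le_pow_of_le_one (by norm_num) (by norm_num) hmono.le_apply) hepos.le))
  obtain ⟨M, hM⟩ := exists_nat_gt (1 / ε)
  rw [div_lt_iff₀ hε] at hM
  obtain ⟨θ, hθ, hθε⟩ := exists_rosenthal_subsequence hε M
    (μ := fun n => μ (φ (f (ψ n)).2.1)) (fun n => hμ _) hO
    (fun n => (((hμ _).mono (Set.subset_univ _)).trans (h1 _)).trans hM.le)
  refine ⟨fun k => φ (f (ψ (θ k))).2.1, fun k => O (θ k), η / 2,
    hφ.comp (hmono'.injective.comp (hψ.comp hθ)), fun i j hij => hO (hθ.ne hij), by positivity,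
    hθε, fun k B hB => ?_⟩
  have hm := hμ (φ (f (ψ (θ k))).2.1)
  -- Both pieces have `ν`-mass at most `η / 2`, so the union has mass at most `a < d + e`. Since `O
  -- (θ k)` already takes `d - 5 * e`, less than `6 * e` remains.
  have e1 : μ (φ (f (ψ (θ k))).2.1) ((B \ O (θ k)) ∪ O (θ k)) ≤ a := by
    rw [Set.sdiff_union_self]
    refine hφη _ _ ((hν.union_le _ _).trans ?_)
    have := (hν.mono (hOA (θ k))).trans (hf (ψ (θ k))).1
    linarith
  rw [hm.union _ _ Set.disjoint_sdiff_left] at e1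
  have e2 := hOm (θ k)
  have : ε = 10 * e := by rw [he]; ring
  linarith

end Content

/-! ### The space of bounded functions and the variation of its functionals -/

/-- The Banach space of bounded real functions on `Γ`. -/
abbrev LInfty (Γ : Type*) := lp (fun _ : Γ => ℝ) ∞

namespace LInfty

variable {Γ : Type*}

lemma norm_le {x : LInfty Γ} {c : ℝ} (hc : 0 ≤ c) (h : ∀ i, |x i| ≤ c) : ‖x‖ ≤ c :=
  lp.norm_le_of_forall_le hc h

lemma abs_apply_le (x : LInfty Γ) (i : Γ) : |x i| ≤ ‖x‖ :=
  lp.norm_apply_le_norm ENNReal.top_ne_zero x i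

/-- The element of `LInfty Γ` given by a bounded function. -/
def ofBound (f : Γ → ℝ) (c : ℝ) (h : ∀ i, |f i| ≤ c) : LInfty Γ :=
  ⟨f, memℓp_infty ⟨c, by rintro _ ⟨i, rfl⟩; exact h i⟩⟩

@[simp] lemma ofBound_apply (f : Γ → ℝ) (c : ℝ) (h : ∀ i, |f i| ≤ c) (i : Γ) :
    ofBound f c h i = f i := rfl

open Classical in
/-- The characteristic function of a set. -/
noncomputable def ind (A : Set Γ) : LInfty Γ :=
  ofBound (fun i => if i ∈ A then 1 else 0) 1 fun i => by split_ifs <;> simp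

open Classical in
@[simp] lemma ind_apply (A : Set Γ) (i : Γ) : ind A i = if i ∈ A then 1 else 0 := rfl

@[simp] lemma apply_mul (x y : LInfty Γ) (i : Γ) : (x * y) i = x i * y i := by
  rw [lp.infty_coeFn_mul]; rfl

@[simp] lemma apply_add (x y : LInfty Γ) (i : Γ) : (x + y) i = x i + y i := rfl

@[simp] lemma apply_sub (x y : LInfty Γ) (i : Γ) : (x - y) i = x i - y i := rfl

@[simp] lemma apply_neg (x : LInfty Γ) (i : Γ) : (-x) i = -x i := rfl

@[simp] lemma apply_smul (c : ℝ) (x : LInfty Γ) (i : Γ) : (c • x) i = c * x i := rfl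

lemma norm_ind_le (A : Set Γ) : ‖ind A‖ ≤ 1 :=
  norm_le zero_le_one fun i => by simp only [ind_apply]; split_ifs <;> simp

lemma ext_apply {x y : LInfty Γ} (h : ∀ i, x i = y i) : x = y := lp.ext (funext h)

end LInfty

section LInfty

open LInfty

variable {Γ : Type*}

lemma exists_norming_seq {E : Type*} [NormedAddCommGroup E] [NormedSpace ℝ E]
    (ξ : StrongDual ℝ E) :
    ∃ b : ℕ → E, (∀ n, ‖b n‖ ≤ 1) ∧ Tendsto (fun n => ξ (b n)) atTop (𝓝 ‖ξ‖) := by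
  have h : ∀ n : ℕ, ∃ x : E, ‖x‖ ≤ 1 ∧ ‖ξ‖ - 1 / ((n : ℝ) + 1) ≤ ξ x := by
    intro n
    have hpos : (0 : ℝ) < 1 / ((n : ℝ) + 1) := by positivity
    obtain ⟨x, hx, hx'⟩ := ξ.exists_lt_apply_of_lt_opNorm
      (show ‖ξ‖ - 1 / ((n : ℝ) + 1) < ‖ξ‖ by linarith)
    rw [Real.norm_eq_abs] at hx'
    rcases abs_cases (ξ x) with ⟨h, -⟩ | ⟨h, -⟩
    · exact ⟨x, hx.le, by linarith⟩
    · exact ⟨-x, by rw [norm_neg]; exact hx.le, by rw [map_neg]; linarith⟩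
  choose b hb hb' using h
  refine ⟨b, hb, tendsto_of_tendsto_of_tendsto_of_le_of_le (g := fun n : ℕ => ‖ξ‖ - 1 / ((n : ℝ) + 1))
    ?_ tendsto_const_nhds hb' fun n => ?_⟩
  · simpa using tendsto_const_nhds.sub (tendsto_one_div_add_atTop_nhds_zero_nat (𝕜 := ℝ))
  · exact (le_abs_self _).trans ((ξ.le_of_opNorm_le le_rfl _).trans
      (mul_le_of_le_one_right (norm_nonneg _) (hb n)))

/-- The total variation of a functional on `LInfty Γ`. -/
lemma exists_variation (ξ : StrongDual ℝ (LInfty Γ)) :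
    ∃ μ : StrongDual ℝ (LInfty Γ), ‖μ‖ ≤ ‖ξ‖ ∧
      (∀ y z : LInfty Γ, (∀ i, |y i| ≤ z i) → |ξ y| ≤ μ z) ∧
      ∀ A : Set Γ, ∀ ε > 0, ∃ s : LInfty Γ, ‖s‖ ≤ 1 ∧ μ (ind A) - ε ≤ ξ (ind A * s) := by
  obtain ⟨b, hb, hlim⟩ := exists_norming_seq ξ
  set U : Ultrafilter ℕ := hyperfilter ℕ
  replace hlim : Tendsto (fun n => ξ (b n)) U (𝓝 ‖ξ‖) := hlim.mono_left Nat.hyperfilter_le_atTop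
  have hbd : ∀ n x, |ξ (x * b n)| ≤ ‖ξ‖ * ‖x‖ := fun n x =>
    (ξ.le_opNorm _).trans (mul_le_mul_of_nonneg_left ((norm_mul_le _ _).trans
      (mul_le_of_le_one_right (norm_nonneg _) (hb n))) (norm_nonneg _))
  have key : ∀ x, ∃ a, Tendsto (fun n => ξ (x * b n)) U (𝓝 a) := fun x => by
    obtain ⟨a, -, ha⟩ := (isCompact_Icc (a := -(‖ξ‖ * ‖x‖)) (b := ‖ξ‖ * ‖x‖)).ultrafilter_le_nhds
      (U.map fun n => ξ (x * b n)) (by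
        simp only [le_principal_iff]
        exact Ultrafilter.mem_map.2 (Filter.univ_mem' fun n => abs_le.1 (hbd n x)))
    exact ⟨a, ha⟩
  choose v hv using key
  -- The norming sequence `b n` acts as an approximate sign of `ξ`, so the limit of `ξ (x * b n)`
  -- plays the role of integration against the variation.
  let μ₀ : LInfty Γ →ₗ[ℝ] ℝ :=
    { toFun := v
      map_add' := fun x y => tendsto_nhds_unique (hv _)
        (((hv x).add (hv y)).congr fun n => by rw [add_mul, map_add])
      map_smul' := fun c x => tendsto_nhds_unique (hv _)
        (((hv x).const_mul c).congr fun n => by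
          rw [smul_mul_assoc, map_smul, smul_eq_mul]) }
  have hμ₀ : ∀ x, ‖μ₀ x‖ ≤ ‖ξ‖ * ‖x‖ := fun x =>
    le_of_tendsto' (hv x).abs fun n => hbd n x
  refine ⟨μ₀.mkContinuous _ hμ₀, μ₀.mkContinuous_norm_le (norm_nonneg _) hμ₀, ?_, ?_⟩
  · have main : ∀ y z : LInfty Γ, (∀ i, |y i| ≤ z i) → ξ y ≤ v z := by
      intro y z hyz
      -- Pointwise `|y + (‖z‖ - z) * b n| ≤ z + (‖z‖ - z) = ‖z‖`. Since `ξ (b n)` tends to `‖ξ‖`,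
      -- the limit leaves `ξ y ≤ v z`.
      have hle : ∀ n, ξ y + ‖z‖ * ξ (b n) - ξ (z * b n) ≤ ‖ξ‖ * ‖z‖ := fun n => by
        have e : ξ y + ‖z‖ * ξ (b n) - ξ (z * b n) = ξ (y + ‖z‖ • b n - z * b n) := by
          simp
        rw [e]
        refine (le_abs_self _).trans ((ξ.le_opNorm _).trans
          (mul_le_mul_of_nonneg_left (norm_le (norm_nonneg _) fun i => ?_) (norm_nonneg _)))
        have h1 := abs_le.1 (hyz i)
        have h2 := abs_le.1 ((abs_apply_le (b n) i).trans (hb n))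
        have h3 := (abs_le.1 (abs_apply_le z i)).2
        simp only [apply_sub, apply_add, apply_smul, apply_mul]
        rw [abs_le]
        constructor <;> nlinarith
      have := le_of_tendsto' ((tendsto_const_nhds.add (hlim.const_mul ‖z‖)).sub (hv z)) hle
      linarith
    intro y z hyz
    refine abs_le'.2 ⟨main y z hyz, ?_⟩
    rw [← map_neg]
    exact main (-y) z fun i => by rw [apply_neg, abs_neg]; exact hyz i
  · intro A ε hε
    obtain ⟨n, hn⟩ := ((hv (ind A)).eventually_const_lt (sub_lt_self _ hε)).exists
    exact ⟨b n, hb n, hn.le⟩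

lemma isContent_of_positive {μ : StrongDual ℝ (LInfty Γ)}
    (hμ : ∀ x : LInfty Γ, (∀ i, 0 ≤ x i) → 0 ≤ μ x) : IsContent fun A => μ (ind A) where
  nonneg A := hμ _ fun i => by simp only [ind_apply]; split_ifs <;> simp
  union A B hAB := by
    rw [← map_add]
    refine congrArg μ (ext_apply fun i => ?_)
    have : i ∈ A → i ∉ B := fun h => Set.disjoint_left.1 hAB h
    by_cases hA : i ∈ A <;> by_cases hB : i ∈ B <;> simp_all

/-! ### Approximating bidual functionals by points of the ball -/

section Approximation

variable {E : Type*} [NormedAddCommGroup E] [NormedSpace ℝ E]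

/-- Finitely many values of a functional in the unit ball of the bidual are approximated by
evaluation at a point of the unit ball. -/
lemma exists_finite_approx {ι : Type*} [Fintype ι] (u : ι → StrongDual ℝ E)
    {F : StrongDual ℝ (StrongDual ℝ E)} (hF : ‖F‖ ≤ 1) {ε : ℝ} (hε : 0 < ε) :
    ∃ b : E, ‖b‖ ≤ 1 ∧ ∀ i, |F (u i) - u i b| ≤ ε := by
  classical
  let T : E →ₗ[ℝ] (ι → ℝ) := LinearMap.pi fun i => (u i : E →ₗ[ℝ] ℝ)
  have hmem : (fun i => F (u i)) ∈ closure (T '' Metric.closedBall 0 1) := by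
    by_contra hcon
    obtain ⟨f, s, hs, hs'⟩ := geometric_hahn_banach_closed_point
      (((convex_closedBall (0 : E) 1).linear_image T).closure) isClosed_closure hcon
    -- A separating functional on `ι → ℝ` is a combination `g` of the `u i` with `‖g‖ ≤ s < F g`,
    -- contradicting `‖F‖ ≤ 1`.
    set g : StrongDual ℝ E := ∑ i, f (Pi.single i 1) • u i with hg
    have hf : ∀ v : ι → ℝ, f v = ∑ i, f (Pi.single i 1) * v i := fun v => by
      conv_lhs => rw [pi_eq_sum_univ' v, map_sum]
      refine Finset.sum_congr rfl fun i _ => ?_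
      rw [map_smul, smul_eq_mul, mul_comm]
    have hgb : ∀ b : E, ‖b‖ ≤ 1 → g b < s := fun b hb => by
      have := hs _ (subset_closure ⟨b, by simpa using hb, rfl⟩)
      rw [hf] at this
      simpa [hg, T] using this
    have hFg : s < F g := by
      rw [hf] at hs'
      simpa [hg] using hs'
    have hs0 : 0 < s := by simpa using hgb 0 (by simp)
    have hgn : ‖g‖ ≤ s := by
      refine ContinuousLinearMap.opNorm_le_of_unit_norm hs0.le fun x hx => ?_
      refine abs_le'.2 ⟨(hgb x hx.le).le, ?_⟩
      rw [← map_neg]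
      exact (hgb (-x) (by rw [norm_neg]; exact hx.le)).le
    have := (le_abs_self _).trans (F.le_of_opNorm_le hF g)
    linarith
  obtain ⟨_, ⟨b, hb, rfl⟩, hb'⟩ := Metric.mem_closure_iff.1 hmem ε hε
  refine ⟨b, by simpa using hb, fun i => ?_⟩
  have := (dist_le_pi_dist _ _ i).trans hb'.le
  rwa [Real.dist_eq] at this

/-- If the functionals `u k` are uniformly small on vectors that are small for a seminorm satisfying
the parallelogram identity (with square `q`), then a functional in the unit ball of the bidual is
approximated, uniformly on all `u k`, by evaluation at a point of the unit ball. -/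
lemma exists_uniform_approx {q : E → ℝ} (hq0 : ∀ x, 0 ≤ q x) {C : ℝ}
    (hqC : ∀ x, ‖x‖ ≤ 1 → q x ≤ C)
    (hpar : ∀ x y, q (x - y) + 4 * q ((1 / 2 : ℝ) • (x + y)) = 2 * q x + 2 * q y)
    {u : ℕ → StrongDual ℝ E} {ε τ : ℝ} (hε : 0 < ε) (hτ : 0 < τ)
    (hu : ∀ k x, ‖x‖ ≤ 2 → q x ≤ τ → |u k x| ≤ ε)
    {F : StrongDual ℝ (StrongDual ℝ E)} (hF : ‖F‖ ≤ 1) :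
    ∃ b : E, ‖b‖ ≤ 1 ∧ ∀ k, |F (u k) - u k b| ≤ 2 * ε := by
  set G : ℕ → Set E := fun m => {b | ‖b‖ ≤ 1 ∧ ∀ k < m, |F (u k) - u k b| ≤ ε} with hG
  have hGne : ∀ m, (G m).Nonempty := fun m => by
    obtain ⟨b, hb, h⟩ := exists_finite_approx (fun i : Fin m => u i) hF hε
    exact ⟨b, hb, fun k hk => h ⟨k, hk⟩⟩
  have hGanti : ∀ {m n}, m ≤ n → G n ⊆ G m := fun h b hb =>
    ⟨hb.1, fun k hk => hb.2 k (hk.trans_le h)⟩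
  have hGmid : ∀ {m x y}, x ∈ G m → y ∈ G m → (1 / 2 : ℝ) • (x + y) ∈ G m := by
    intro m x y hx hy
    refine ⟨?_, fun k hk => ?_⟩
    · rw [norm_smul, Real.norm_of_nonneg (by norm_num)]
      have := norm_add_le x y
      have := hx.1
      have := hy.1
      linarith
    · have h1 := abs_le.1 (hx.2 k hk)
      have h2 := abs_le.1 (hy.2 k hk)
      rw [map_smul, map_add, smul_eq_mul, abs_le]
      constructor <;> linarith
  have hbdd : ∀ m, BddBelow (q '' G m) := fun m => ⟨0, by rintro _ ⟨x, -, rfl⟩; exact hq0 x⟩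
  set I : ℕ → ℝ := fun m => sInf (q '' G m) with hI
  have hIle : ∀ {m x}, x ∈ G m → I m ≤ q x := fun hx => csInf_le (hbdd _) ⟨_, hx, rfl⟩
  have hIC : ∀ m, I m ≤ C := fun m => by
    obtain ⟨x, hx⟩ := hGne m
    exact (hIle hx).trans (hqC x hx.1)
  have hIbdd : BddAbove (Set.range I) := ⟨C, by rintro _ ⟨m, rfl⟩; exact hIC m⟩
  -- The infima `I m` are bounded, so past `m₀` they gain at most `τ / 8`.
  obtain ⟨m₀, hm₀⟩ := exists_lt_of_lt_ciSup (sub_lt_self (⨆ m, I m) (by positivity : 0 < τ / 8))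
  have hIm : ∀ m, I m ≤ I m₀ + τ / 8 := fun m => by
    have := le_ciSup hIbdd m
    linarith
  have hnear : ∀ m, ∃ x ∈ G m, q x < I m + τ / 8 := fun m => by
    obtain ⟨_, ⟨x, hx, rfl⟩, h⟩ := Real.lt_sInf_add_pos ((hGne m).image q)
      (by positivity : 0 < τ / 8)
    exact ⟨x, hx, h⟩
  choose b hbG hbq using hnear
  refine ⟨b m₀, (hbG m₀).1, fun k => ?_⟩
  set m := max m₀ (k + 1) with hm
  have hbm : b m ∈ G m₀ := hGanti (le_max_left _ _) (hbG m)
  -- The midpoint lies in `G m₀`, so the parallelogram identity bounds `q (b m - b m₀)` by `3 * τ /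
  -- 4`; thus `u k` barely distinguishes `b m₀` from `b m`, which is accurate at `k`.
  have e1 := hpar (b m) (b m₀)
  have e2 := hIle (hGmid hbm (hbG m₀))
  have e3 := hbq m
  have e4 := hbq m₀
  have e5 := hIm m
  have e6 := hu k (b m - b m₀) ((norm_sub_le _ _).trans (by
    have := (hbG m).1
    have := (hbG m₀).1
    linarith)) (by linarith)
  have e7 := (hbG m).2 k (lt_of_lt_of_le k.lt_succ_self (le_max_right _ _))
  rw [map_sub] at e6
  rw [abs_le] at *
  constructor <;> linarith

end Approximation

/-! ### Gluing in the space of bounded functions -/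

/-- Every functional in the unit ball of the bidual of `LInfty Γ` is almost dominated, along
infinitely many members of a sequence of functionals, by evaluation at a point of the unit ball. -/
lemma exists_infinite_almost_le {ξ : ℕ → StrongDual ℝ (LInfty Γ)} (hξ : ∀ n, ‖ξ n‖ ≤ 1)
    {F : StrongDual ℝ (StrongDual ℝ (LInfty Γ))} (hF : ‖F‖ ≤ 1) {ε : ℝ} (hε : 0 < ε) :
    ∃ b : LInfty Γ, ‖b‖ ≤ 1 ∧ {n | F (ξ n) - ε ≤ ξ n b}.Infinite := by
  classical
  choose μ hμn hμd hμs using fun n => exists_variation (ξ n)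
  have hμ1 : ∀ n, ‖μ n‖ ≤ 1 := fun n => (hμn n).trans (hξ n)
  have hμpos : ∀ n (x : LInfty Γ), (∀ i, 0 ≤ x i) → 0 ≤ μ n x := fun n x hx =>
    (abs_nonneg _).trans (hμd n 0 x (by simpa using hx))
  have hμc := fun n => isContent_of_positive (hμpos n)
  have hμuniv : ∀ n, μ n (ind Set.univ) ≤ 1 := fun n =>
    (le_abs_self _).trans (((μ n).le_of_opNorm_le (hμ1 n) _).trans
      (by simpa using norm_ind_le Set.univ))
  obtain ⟨ν, hν⟩ : ∃ ν : StrongDual ℝ (LInfty Γ),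
      ∀ x, HasSum (fun n => (1 / 2 : ℝ) ^ n * μ n x) (ν x) := by
    have hs : Summable fun n : ℕ => (1 / 2 : ℝ) ^ n • μ n :=
      Summable.of_norm_bounded summable_geometric_two fun n => by
        rw [norm_smul, Real.norm_of_nonneg (by positivity)]
        exact mul_le_of_le_one_right (by positivity) (hμ1 n)
    exact ⟨_, fun x => hs.hasSum.mapL (ContinuousLinearMap.apply ℝ ℝ x)⟩
  have hνpos : ∀ x : LInfty Γ, (∀ i, 0 ≤ x i) → 0 ≤ ν x := fun x hx =>
    (hν x).nonneg fun n => mul_nonneg (by positivity) (hμpos n x hx)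
  have hνc := isContent_of_positive hνpos
  have hdom : ∀ n A, μ n (ind A) ≤ 2 ^ n * ν (ind A) := fun n A => by
    have h := le_hasSum (hν (ind A)) n fun j _ => mul_nonneg (by positivity) ((hμc j).nonneg A)
    calc μ n (ind A) = 2 ^ n * ((1 / 2 : ℝ) ^ n * μ n (ind A)) := by
          rw [← mul_assoc, ← mul_pow]; norm_num
      _ ≤ _ := by gcongr
  -- Final losses: `6 * e` for `b` off `O k`, `e` for `s k` on `O k`, and `2 * e` for the other sets
  -- `O j`.
  set e := ε / 10 with he
  have hepos : 0 < e := by positivity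
  obtain ⟨φ, O, η, hφ, hO, hη, hOe, hηe⟩ := exists_subsequence_splitting hμc hμuniv hνc
    (c := fun n => 2 ^ n) (fun n => by positivity) hdom hepos
  set u : ℕ → StrongDual ℝ (LInfty Γ) := fun k =>
    (ξ (φ k)).comp (ContinuousLinearMap.mul ℝ (LInfty Γ) (ind (O k)ᶜ)) with hu
  have hu_apply : ∀ k x, u k x = ξ (φ k) (ind (O k)ᶜ * x) := fun k x => rfl
  obtain ⟨b, hb, hbu⟩ := exists_uniform_approx (q := fun x => ν (x * x)) (C := ‖ν‖)
    (fun x => hνpos _ fun i => by rw [apply_mul]; exact mul_self_nonneg _)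
    (fun x hx => (le_abs_self _).trans ((ν.le_opNorm _).trans
      (mul_le_of_le_one_right (norm_nonneg _) ((norm_mul_le _ _).trans
        (mul_le_one₀ hx (norm_nonneg _) hx)))))
    (fun x y => by
      have h : (x - y) * (x - y) + (4 : ℝ) • (((1 / 2 : ℝ) • (x + y)) * ((1 / 2 : ℝ) • (x + y))) =
          (2 : ℝ) • (x * x) + (2 : ℝ) • (y * y) := ext_apply fun i => by
        simp only [apply_add, apply_mul, apply_sub, apply_smul]
        ring
      simpa using congrArg ν h)
    -- With `τ = e ^ 2 * η`, Chebyshev gives `ν {e < |x|} ≤ η`. This set contributes at most `2 * e`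
    -- as `‖x‖ ≤ 2`, and its complement at most `e`.
    (u := u) (ε := 3 * e) (τ := e ^ 2 * η) (by positivity) (by positivity)
    (fun k x hx hxτ => by
      set B : Set Γ := {i | e < |x i|} with hB
      have hBη : ν (ind B) ≤ η := by
        have h := hνpos (x * x - e ^ 2 • ind B) fun i => by
          simp only [apply_sub, apply_mul, apply_smul, ind_apply]
          split_ifs with h
          · have : e < |x i| := h
            nlinarith [abs_mul_abs_self (x i)]
          · nlinarith [mul_self_nonneg (x i)]
        rw [map_sub, map_smul, smul_eq_mul] at h
        exact le_of_mul_le_mul_left (by linarith) (by positivity : 0 < e ^ 2)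
      have h := hμd (φ k) (ind (O k)ᶜ * x) ((2 : ℝ) • ind (B \ O k) + e • ind Set.univ) fun i => by
        have h2 := (abs_apply_le x i).trans hx
        by_cases hiO : i ∈ O k
        · simpa [hiO] using hepos.le
        · by_cases hiB : i ∈ B
          · simp only [apply_mul, ind_apply, Set.mem_compl_iff, hiO, apply_add, apply_smul,
              Set.mem_sdiff, hiB, Set.mem_univ]
            norm_num
            linarith
          · have : |x i| ≤ e := not_lt.1 hiB
            simpa [hiO, hiB] using this
      rw [map_add, map_smul, map_smul, smul_eq_mul, smul_eq_mul] at h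
      rw [hu_apply]
      have h3 := hηe k B hBη
      have h4 := hμuniv (φ k)
      nlinarith) hF
  choose s hs1 hs2 using fun k => hμs (φ k) (O k) e hepos
  have hglue : ∃ x : LInfty Γ, ‖x‖ ≤ 1 ∧ (∀ k, ∀ i ∈ O k, x i = s k i) ∧
      ∀ i, (∀ k, i ∉ O k) → x i = b i := by
    have hbd : ∀ i, |if h : ∃ k, i ∈ O k then s h.choose i else b i| ≤ 1 := fun i => by
      split_ifs with h
      · exact (abs_apply_le _ i).trans (hs1 _)
      · exact (abs_apply_le _ i).trans hb
    refine ⟨ofBound _ 1 hbd, norm_le zero_le_one hbd, fun k i hi => ?_, fun i hi => ?_⟩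
    · have h : ∃ k, i ∈ O k := ⟨k, hi⟩
      have hk : h.choose = k := by
        by_contra hne
        exact Set.disjoint_left.1 (hO hne) h.choose_spec hi
      rw [ofBound_apply, dif_pos h, hk]
    · rw [ofBound_apply, dif_neg (by simpa using hi)]
  obtain ⟨x, hx1, hxO, hxb⟩ := hglue
  refine ⟨x, hx1, Set.infinite_of_injective_forall_mem hφ fun k => ?_⟩
  change F (ξ (φ k)) - ε ≤ ξ (φ k) x
  set w : StrongDual ℝ (LInfty Γ) :=
    (ξ (φ k)).comp (ContinuousLinearMap.mul ℝ (LInfty Γ) (ind (O k))) with hw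
  have hw_apply : ∀ y, w y = ξ (φ k) (ind (O k) * y) := fun y => rfl
  -- On `O k` no approximation of `F` is needed: `F w ≤ ‖w‖` is at most the variation, which `s k`
  -- nearly attains.
  have hwn : ‖w‖ ≤ μ (φ k) (ind (O k)) := by
    refine w.opNorm_le_bound ((hμc _).nonneg _) fun y => ?_
    have h := hμd (φ k) (ind (O k) * y) (‖y‖ • ind (O k)) fun i => by
      by_cases hi : i ∈ O k
      · simpa [hi] using abs_apply_le y i
      · simp [hi]
    rw [map_smul, smul_eq_mul] at h
    rw [mul_comm]
    exact h
  have hsum : ξ (φ k) = u k + w := by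
    ext y
    rw [_root_.add_apply, hu_apply, hw_apply, ← map_add]
    congr 1
    refine ext_apply fun i => ?_
    by_cases hi : i ∈ O k <;> simp [hi]
  have hFw : F w ≤ μ (φ k) (ind (O k)) := by
    have := (le_abs_self _).trans (F.le_of_opNorm_le hF w)
    linarith
  have hFξ : F (ξ (φ k)) = F (u k) + F w := by rw [hsum, map_add]
  have hpos : ∀ i, 0 ≤ ((2 : ℝ) • ind (⋃ j ≠ k, O j)) i := fun i => by
    rw [apply_smul, ind_apply]
    split_ifs <;> norm_num
  -- The difference vanishes except on the other `O j`, where it is `x - b`, of size at most `2`.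
  have hrest := hμd (φ k) (x - ind (O k) * s k - ind (O k)ᶜ * b) ((2 : ℝ) • ind (⋃ j ≠ k, O j))
    fun i => by
      by_cases hi : i ∈ O k
      · simpa [hi, hxO k i hi] using hpos i
      · by_cases hj : ∃ j, i ∈ O j
        · obtain ⟨j, hj⟩ := hj
          have hjk : j ≠ k := by rintro rfl; exact hi hj
          have hm : i ∈ ⋃ j ≠ k, O j := Set.mem_biUnion (x := j) hjk hj
          have h1 := abs_le.1 ((abs_apply_le x i).trans hx1)
          have h2 := abs_le.1 ((abs_apply_le b i).trans hb)
          simp only [apply_sub, apply_mul, ind_apply, apply_smul, if_pos hm,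
            Set.mem_compl_iff, hi, not_false_eq_true, if_true, if_false]
          rw [abs_le]
          constructor <;> linarith
        · push Not at hj
          simpa [hi, hxb i hj] using hpos i
  rw [map_sub, map_sub, map_smul, smul_eq_mul] at hrest
  have h1 := (abs_le.1 hrest).1
  have h2 := hOe k
  have h3 := hs2 k
  have h4 := (abs_le.1 (hbu k)).2
  rw [hu_apply k b] at h4
  have : ε = 10 * e := by rw [he]; ring
  linarith

end LInfty

/-! ### Weak-star compactness, separation and the sequential criterion -/

lemma isCompact_convexJoin {E : Type*} [AddCommGroup E] [Module ℝ E] [TopologicalSpace E]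
    [IsTopologicalAddGroup E] [ContinuousSMul ℝ E] {s t : Set E} (hs : IsCompact s)
    (ht : IsCompact t) : IsCompact (convexJoin ℝ s t) := by
  have h : convexJoin ℝ s t =
      (fun p : ℝ × E × E => (1 - p.1) • p.2.1 + p.1 • p.2.2) '' (Set.Icc 0 1 ×ˢ s ×ˢ t) := by
    ext x
    simp only [mem_convexJoin, segment_eq_image, Set.mem_image, Set.mem_prod, Prod.exists]
    constructor
    · rintro ⟨a, ha, b, hb, θ, hθ, rfl⟩
      exact ⟨θ, a, b, ⟨hθ, ha, hb⟩, rfl⟩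
    · rintro ⟨θ, a, b, ⟨hθ, ha, hb⟩, rfl⟩
      exact ⟨a, ha, b, hb, θ, hθ, rfl⟩
  rw [h]
  exact (isCompact_Icc.prod (hs.prod ht)).image (by fun_prop)

/-- Finitely many compact convex subsets of a convex set `H` lie in a compact convex subset
of `H`. -/
lemma exists_isCompact_convex_superset {E : Type*} [AddCommGroup E] [Module ℝ E]
    [TopologicalSpace E] [IsTopologicalAddGroup E] [ContinuousSMul ℝ E] {K : ℕ → Set E}
    (hK : ∀ i, IsCompact (K i)) (hconv : ∀ i, Convex ℝ (K i)) {H : Set E} (hH : Convex ℝ H)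
    (hKH : ∀ i, K i ⊆ H) (n : ℕ) :
    ∃ P, IsCompact P ∧ Convex ℝ P ∧ P ⊆ H ∧ ∀ i < n, K i ⊆ P := by
  induction n with
  | zero => exact ⟨∅, isCompact_empty, convex_empty, Set.empty_subset _, by simp⟩
  | succ n ih =>
    obtain ⟨P, hP, hPc, hPH, hPK⟩ := ih
    refine ⟨convexHull ℝ (P ∪ K n), ?_, convex_convexHull ℝ _,
      convexHull_min (Set.union_subset hPH (hKH n)) hH, fun i hi => ?_⟩
    · rcases P.eq_empty_or_nonempty with rfl | hPne
      · rw [Set.empty_union, (hconv n).convexHull_eq]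
        exact hK n
      · rcases (K n).eq_empty_or_nonempty with hKe | hKne
        · rw [hKe, Set.union_empty, hPc.convexHull_eq]
          exact hP
        · rw [hPc.convexHull_union (hconv n) hPne hKne]
          exact isCompact_convexJoin hP (hK n)
    · rcases Nat.lt_succ_iff_lt_or_eq.1 hi with h | rfl
      · exact (hPK i h).trans (Set.subset_union_left.trans (subset_convexHull ℝ _))
      · exact Set.subset_union_right.trans (subset_convexHull ℝ _)

section Dual

variable {X : Type*} [NormedAddCommGroup X] [NormedSpace ℝ X]

instance WeakDual.locallyConvexSpace : LocallyConvexSpace ℝ (WeakDual ℝ X) :=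
  (WeakDual.withSeminorms (𝕜 := ℝ) (E := X)).toLocallyConvexSpace

lemma convex_preimage_toStrongDual {s : Set (StrongDual ℝ X)} (hs : Convex ℝ s) :
    Convex ℝ ((WeakDual.toStrongDual : WeakDual ℝ X → StrongDual ℝ X) ⁻¹' s) :=
  hs.linear_preimage (WeakDual.toStrongDual : WeakDual ℝ X ≃ₗ[ℝ] StrongDual ℝ X).toLinearMap

/-- Strong separation of a functional from a weak-star compact convex set by an element of the
predual. -/
lemma exists_separating_of_lt_dist {P : Set (WeakDual ℝ X)} (hP : IsCompact P)
    (hPc : Convex ℝ P) {F : StrongDual ℝ X} {ε : ℝ} (hε : 0 ≤ ε)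
    (h : ∀ G ∈ P, ε < dist (WeakDual.toStrongDual G) F) :
    ∃ x : X, ‖x‖ ≤ 1 ∧ ∀ G ∈ P, G x + ε ≤ F x := by
  obtain ⟨f, a, b, hfa, hab, hfb⟩ := geometric_hahn_banach_compact_closed hPc hP
    (convex_preimage_toStrongDual (convex_closedBall F ε)) (WeakDual.isClosed_closedBall F ε)
    (Set.disjoint_left.2 fun G hG hG' => (h G hG).not_ge hG')
  obtain ⟨x, rfl⟩ := LinearMap.dualEmbedding_surjective (topDualPairing ℝ X) f
  obtain ⟨g, hg, hgx⟩ := exists_dual_vector'' ℝ x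
  -- Testing the separation at the point `F - ε • g` of the ball, with `g` norming `x`, turns it
  -- into a gap `ε * ‖x‖`.
  have hb : b < F x - ε * ‖x‖ := by
    have := hfb (StrongDual.toWeakDual (F - ε • g)) (by
      change dist (F - ε • g) F ≤ ε
      rw [dist_eq_norm, sub_sub_cancel_left, norm_neg, norm_smul, Real.norm_of_nonneg hε]
      exact mul_le_of_le_one_right hε hg)
    have e : (F - ε • g) x = F x - ε * ‖x‖ := by simp [hgx]
    rw [← e]
    exact this
  have ha : ∀ G ∈ P, G x + ε * ‖x‖ < F x := fun G hG => by
    have : G x < a := hfa G hG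
    linarith
  -- If `x = 0`, then `P` is empty and the zero vector serves.
  refine ⟨‖x‖⁻¹ • x, ?_, fun G hG => ?_⟩
  · rw [norm_smul, norm_inv, norm_norm]
    exact inv_mul_le_one
  · have hx : 0 < ‖x‖ := by
      rw [norm_pos_iff]
      rintro rfl
      have := ha G hG
      simp at this
    have hG' := ha G hG
    rw [map_smul, map_smul, smul_eq_mul, smul_eq_mul]
    have : ‖x‖⁻¹ * (G x + ε * ‖x‖) ≤ ‖x‖⁻¹ * F x := by gcongr
    rw [mul_add, mul_comm ε, inv_mul_cancel_left₀ hx.ne'] at this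
    exact this

lemma weakStarClosure_convexHull_subset {A : Set (StrongDual ℝ X)} {r : ℝ}
    (hA : A ⊆ Metric.closedBall 0 r) :
    weakStarClosure (convexHull ℝ A) ⊆ Metric.closedBall 0 r := by
  intro G hG
  refine closure_minimal ?_ (WeakDual.isClosed_closedBall (0 : StrongDual ℝ X) r) hG
  rintro _ ⟨G', hG', rfl⟩
  exact convexHull_min hA (convex_closedBall _ _) hG'

lemma iEnvelope_subset_closedBall {B : Set (StrongDual ℝ X)} {r : ℝ}
    (hB : B ⊆ Metric.closedBall 0 r) : iEnvelope B ⊆ Metric.closedBall 0 r := by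
  intro F hF
  have := Set.mem_iInter₂.1 hF (fun _ => B) (Set.iUnion_const B).symm
  refine closure_minimal (convexHull_min (Set.iUnion_subset fun _ => ?_) (convex_closedBall _ _))
    Metric.isClosed_closedBall this
  exact weakStarClosure_convexHull_subset hB

/-- A functional outside the (I)-envelope of a bounded set `B` is strictly separated, by a sequence
in the unit ball of the predual, eventually from each point of `B`. -/
lemma exists_separating_seq_of_notMem_iEnvelope {B : Set (StrongDual ℝ X)} {r : ℝ}
    (hB : B ⊆ Metric.closedBall 0 r) {F : StrongDual ℝ X} (hF : F ∉ iEnvelope B) :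
    ∃ (ξ : ℕ → X) (ε : ℝ), 0 < ε ∧ (∀ n, ‖ξ n‖ ≤ 1) ∧
      ∀ G ∈ B, ∀ᶠ n in atTop, G (ξ n) + ε ≤ F (ξ n) := by
  simp only [iEnvelope, Set.mem_iInter, not_forall] at hF
  obtain ⟨C, hC, hF⟩ := hF
  set H := convexHull ℝ (⋃ n, weakStarClosure (convexHull ℝ (C n)))
  obtain ⟨ε, hε, hdist⟩ : ∃ ε > 0, ∀ G ∈ H, ε < dist G F := by
    rw [Metric.mem_closure_iff] at hF
    push Not at hF
    obtain ⟨ε, hε, h⟩ := hF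
    exact ⟨ε / 2, by positivity, fun G hG => by
      have := h G hG
      rw [dist_comm] at this
      linarith⟩
  set K : ℕ → Set (WeakDual ℝ X) := fun n =>
    closure ((StrongDual.toWeakDual : StrongDual ℝ X → WeakDual ℝ X) '' convexHull ℝ (C n)) with hK
  have hKcomp : ∀ n, IsCompact (K n) := fun n => by
    refine (WeakDual.isCompact_closedBall (𝕜 := ℝ) (0 : StrongDual ℝ X) r).of_isClosed_subset
      isClosed_closure ?_
    intro G hG
    exact weakStarClosure_convexHull_subset
      ((hC ▸ Set.subset_iUnion C n : C n ⊆ B).trans hB) hG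
  have hKconv : ∀ n, Convex ℝ (K n) := fun n => by
    refine Convex.closure ?_
    exact (convex_convexHull ℝ (C n)).linear_image
      (StrongDual.toWeakDual : StrongDual ℝ X ≃ₗ[ℝ] WeakDual ℝ X).toLinearMap
  have key : ∀ n, ∃ x : X, ‖x‖ ≤ 1 ∧ ∀ i < n, ∀ G ∈ C i, G x + ε ≤ F x := fun n => by
    have hHc : Convex ℝ ((WeakDual.toStrongDual : WeakDual ℝ X → StrongDual ℝ X) ⁻¹' H) :=
      convex_preimage_toStrongDual (convex_convexHull ℝ _)
    have hKH : ∀ i, weakStarClosure (convexHull ℝ (C i)) ⊆ H := fun i =>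
      (Set.subset_iUnion (fun i => weakStarClosure (convexHull ℝ (C i))) i).trans
        (subset_convexHull ℝ _)
    obtain ⟨P, hP, hPc, hPH, hPK⟩ := exists_isCompact_convex_superset hKcomp hKconv hHc hKH n
    obtain ⟨x, hx, h⟩ := exists_separating_of_lt_dist hP hPc hε.le
      fun G hG => hdist _ (hPH hG)
    refine ⟨x, hx, fun i hi G hG => h (StrongDual.toWeakDual G) (hPK i hi ?_)⟩
    exact subset_closure ⟨G, subset_convexHull ℝ _ hG, rfl⟩
  choose ξ hξ h using key
  refine ⟨ξ, ε, hε, hξ, fun G hG => ?_⟩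
  rw [hC] at hG
  obtain ⟨i, hi⟩ := Set.mem_iUnion.1 hG
  filter_upwards [eventually_gt_atTop i] with n hn using h n i hn G hi

lemma inclusionInDoubleDual_image_closedBall_subset :
    NormedSpace.inclusionInDoubleDual ℝ X '' Metric.closedBall 0 1 ⊆ Metric.closedBall 0 1 := by
  rintro _ ⟨x, hx, rfl⟩
  exact (mem_closedBall_zero_iff (E := StrongDual ℝ (StrongDual ℝ X))).2
    ((NormedSpace.double_dual_bound ℝ X x).trans (mem_closedBall_zero_iff.1 hx))

/-- A sequential criterion for the (I)-envelope of the unit ball to be the unit ball of the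
bidual. -/
lemma iEnvelopeInBidual_closedBall_eq
    (h : ∀ ξ : ℕ → StrongDual ℝ X, (∀ n, ‖ξ n‖ ≤ 1) → ∀ F : StrongDual ℝ (StrongDual ℝ X),
      ‖F‖ ≤ 1 → ∀ ε > 0, ∃ b : X, ‖b‖ ≤ 1 ∧ {n | F (ξ n) - ε ≤ ξ n b}.Infinite) :
    iEnvelopeInBidual (Metric.closedBall (0 : X) 1) =
      Metric.closedBall (0 : StrongDual ℝ (StrongDual ℝ X)) 1 := by
  refine Set.Subset.antisymm
    (iEnvelope_subset_closedBall inclusionInDoubleDual_image_closedBall_subset) fun F hF => ?_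
  by_contra hcon
  obtain ⟨ξ, ε, hε, hξ, hsep⟩ := exists_separating_seq_of_notMem_iEnvelope
    inclusionInDoubleDual_image_closedBall_subset hcon
  obtain ⟨b, hb, hinf⟩ := h ξ hξ F
    ((mem_closedBall_zero_iff (E := StrongDual ℝ (StrongDual ℝ X))).1 hF) _ (half_pos hε)
  have hev := hsep _ ⟨b, mem_closedBall_zero_iff.2 hb, rfl⟩
  obtain ⟨n, hn, hn'⟩ := ((Nat.frequently_atTop_iff_infinite.2 hinf).and_eventually hev).exists
  have hn'' : ξ n b + ε ≤ F (ξ n) := hn'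
  have : F (ξ n) - ε / 2 ≤ ξ n b := hn
  linarith

end Dual

theorem theorem4p1 (Γ : Type*) :
    iEnvelopeInBidual (Metric.closedBall (0 : lp (fun _ : Γ => ℝ) ∞) 1) =
      Metric.closedBall (0 : StrongDual ℝ (StrongDual ℝ (lp (fun _ : Γ => ℝ) ∞))) 1 :=
  iEnvelopeInBidual_closedBall_eq fun _ hξ _ hF _ hε => exists_infinite_almost_le hξ hF hε
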